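/- Let $\Omega=[0,1]$. For integers $W,L\ge 1$ let $\Upsilon^{W,L}(\mathrm{ReLU};1,1)$ be the set of all output functions of fully connected feed-forward neural networks with one input, one output, $L$ hidden layers each of width $W$, and activation function $\mathrm{ReLU}(t)=\max\{0,t\}$; that is, all functions $S:\mathbb{R}\to\mathbb{R}$ of the form $$S(x)=A^{(L+1)}X^{(L)}+b^{(L+1)},\qquad X^{(0)}=x,\qquad X^{(\ell)}=\mathrm{ReLU}\bigl(A^{(\ell)}X^{(\ell-1)}+b^{(\ell)}\bigr),\quad \ell=1,\dots,L,$$ with $\mathrm{ReLU}$ acting coordinatewise and arbitrary real weight matrices $A^{(1)}\in\mathbb{R}^{W\times 1}$, $A^{(\ell)}\in\mathbb{R}^{W\times W}$ for $2\le\ell\le L$, $A^{(L+1)}\in\mathbb{R}^{1\times W}$ and bias vectors $b^{(\ell)}\in\mathbb{R}^{W}$ for $1\le \ell\le L$, $b^{(L+1)}\in\mathbb{R}$. Let $K=U(\mathrm{Lip}\,1)$ be the unit ball of the space of Lipschitz functions on $\Omega$ with the norm $|f|_{\mathrm{Lip}\,1}+\|f\|_{C(\Omega)}$, where $|f|_{\mathrm{Lip}\,1}$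 is the smallest Lipschitz constant of $f$ and $\|f\|_{C(\Omega)}=\max_{x\in\Omega}|f(x)|$. Put $\Sigma_n:=\Upsilon^{11,16n+2}(\mathrm{ReLU};1,1)$, its elements being regarded as functions on $\Omega$. Then $$E(K,\Sigma_n)_{C(\Omega)}:=\sup_{f\in K}\ \inf_{S\in\Sigma_n}\|f-S\|_{C(\Omega)}\le 6n^{-2}\qquad\text{for every integer } n\ge 1.$$ -/

import Mathlib

open scoped ENNReal NNReal

/-- The parameters of a fully connected feed-forward network: `FCNetwork d ws d'` has input
dimension `d`, output dimension `d'`, and hidden layers of widths `ws` (first hidden layer first).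
Every layer carries a weight matrix and a bias vector. -/
inductive FCNetwork : ℕ → List ℕ → ℕ → Type
  | output {d d' : ℕ} (A : Matrix (Fin d') (Fin d) ℝ) (b : Fin d' → ℝ) : FCNetwork d [] d'
  | hidden {d m d' : ℕ} {ws : List ℕ} (A : Matrix (Fin m) (Fin d) ℝ) (b : Fin m → ℝ)
      (rest : FCNetwork m ws d') : FCNetwork d (m :: ws) d'

/-- The output function of a network with activation `σ`: `σ` acts coordinatewise at each hidden
layer, and the output layer is affine. -/
def FCNetwork.eval (σ : ℝ → ℝ) :
    {d d' : ℕ} → {ws : List ℕ} → FCNetwork d ws d' → (Fin d → ℝ) → (Fin d' → ℝ)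
  | _, _, _, .output A b, x => A.mulVec x + b
  | _, _, _, .hidden A b rest, x => rest.eval σ (fun i => σ ((A.mulVec x + b) i))

/-- The set `Υ^{W,L}(σ; d, d')` of output functions of networks with `L` hidden layers, all of
width `W`. -/
def Upsilon (W L : ℕ) (σ : ℝ → ℝ) (d d' : ℕ) : Set ((Fin d → ℝ) → (Fin d' → ℝ)) :=
  {S | ∃ N : FCNetwork d (List.replicate L W) d', S = N.eval σ}

/-- The rectified linear unit `t ↦ max {0, t}`. -/
noncomputable def ReLU (t : ℝ) : ℝ := max 0 t

/-- `Υ^{W,L}(ReLU; 1, 1)`, its members regarded as functions on `Ω = [0,1]`, as a subset of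
`C(Ω)`. -/
def UpsilonReLUOnUnitInterval (W L : ℕ) : Set C(Set.Icc (0 : ℝ) 1, ℝ) :=
  {g | ∃ S ∈ Upsilon W L ReLU 1 1, ∀ t : Set.Icc (0 : ℝ) 1, g t = S (fun _ => (t : ℝ)) 0}

/-- The space `Lip 1` on `[0,1]`. -/
def LipOne : Set C(Set.Icc (0 : ℝ) 1, ℝ) :=
  {f | ∃ M : ℝ, ∀ s t : Set.Icc (0 : ℝ) 1, |f s - f t| ≤ M * |(s : ℝ) - t|}

/-- The semi-norm of `Lip 1`: the smallest Lipschitz constant (only meaningful on `LipOne`). -/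
noncomputable def lipSeminorm (f : C(Set.Icc (0 : ℝ) 1, ℝ)) : ℝ :=
  sInf {M : ℝ | ∀ s t : Set.Icc (0 : ℝ) 1, |f s - f t| ≤ M * |(s : ℝ) - t|}

/-- The unit ball `U(Lip 1)`, for the norm `|f|_{Lip 1} + ‖f‖_{C([0,1])}` of `Lip 1`. -/
def unitBallLipOne : Set C(Set.Icc (0 : ℝ) 1, ℝ) :=
  {f | f ∈ LipOne ∧ lipSeminorm f + ‖f‖ ≤ 1}

/-- The class error `E(K, Σ)_X = sup_{f ∈ K} inf_{g ∈ Σ} ‖f - g‖_X`, with values in `[0, ∞]`. -/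
noncomputable def classError {X : Type*} [NormedAddCommGroup X] (K Sig : Set X) : ℝ≥0∞ :=
  ⨆ f ∈ K, ⨅ g ∈ Sig, ‖f - g‖ₑ

/-!
A network of width `O(1)` and depth `O(n)` has only `O(n)` parameters, and reaches the error
`O(n⁻²)` by packing many bits into one parameter.

Let `N = M = 2n` and rescale `[0,1]` to `[0,N]`, so that `f` becomes a `1`-Lipschitz function `φ` of
`y`. Let `P` be the piecewise linear interpolant of `φ` at the integers. The residual `φ - P`
vanishes at the integers and is `2`-Lipschitz on each `[m, m+1]`, so it is bounded by `2 T`, where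
`T` is the distance to the integers (`abs_residual_le`). On the grid of mesh `1/M` in `[m, m+1]` it
is tracked by a sequence with increments `±2/M`, that is, by `M` bits (`exists_bits_residual`),
which are stored in a single number `ternaryCode`.

The functions `P`, `T`, the integer part of `y` and the code that belongs to it are piecewise linear
functions of `y` with `O(N)` breakpoints, up to steep ramps of width `1/M` that make the last two
continuous; they are computed by one layer for each `m` (`isRealized_sums`). Two layers then read
off one digit of the code and add the corresponding piece of the polygon `g` that approximates the
residual (`isRealized_polygonMap`, `polygonMap_apply`). On the steep ramps `g` is meaningless. But
these ramps are adjacent to integers, where both the residual and `T` are small, so truncating `g`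
to `[-2T, 2T]` gives an admissible value there and does no harm elsewhere
(`abs_sub_truncation_le`). The error is at most `8 / M` in the variable `y`, hence
`8 / (M N) = 2 n⁻²` for `f`, with `N + 2 M + 2 = 6 n + 2` hidden layers; the remaining layers merely
carry values.

The bookkeeping rests on `IsRealized W k s`, which says that all functions in `s` are affine
combinations of the neurons of a `k`-th hidden layer of width `W`: by `IsRealized.succ` a further
layer can apply `ReLU` to, or simply carry, up to `W` such combinations.
-/

/-! ### Layers acting on spaces of functions -/

/-- The coordinatewise action of `ReLU` on continuous functions on `[0,1]`. -/
noncomputable def reluMap (h : C(Set.Icc (0 : ℝ) 1, ℝ)) : C(Set.Icc (0 : ℝ) 1, ℝ) := 0 ⊔ h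

theorem reluMap_apply (h : C(Set.Icc (0 : ℝ) 1, ℝ)) (t : Set.Icc (0 : ℝ) 1) :
    reluMap h t = max 0 (h t) := rfl

/-- The span of a set of functions together with the constants: the functions that an affine map
can produce from the values of the functions in `s`. -/
noncomputable def spanWithConst (s : Set C(Set.Icc (0 : ℝ) 1, ℝ)) :
    Submodule ℝ C(Set.Icc (0 : ℝ) 1, ℝ) :=
  Submodule.span ℝ (insert 1 s)

theorem mem_spanWithConst_self {s : Set C(Set.Icc (0 : ℝ) 1, ℝ)} {h : C(Set.Icc (0 : ℝ) 1, ℝ)}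
    (hh : h ∈ s) : h ∈ spanWithConst s :=
  Submodule.subset_span (Set.mem_insert_of_mem _ hh)

theorem one_mem_spanWithConst (s : Set C(Set.Icc (0 : ℝ) 1, ℝ)) : 1 ∈ spanWithConst s :=
  Submodule.subset_span (Set.mem_insert _ _)

theorem spanWithConst_le {s t : Set C(Set.Icc (0 : ℝ) 1, ℝ)} (h : ∀ f ∈ s, f ∈ spanWithConst t) :
    spanWithConst s ≤ spanWithConst t := by
  refine Submodule.span_le.2 (Set.insert_subset (one_mem_spanWithConst t) h)

theorem exists_coeff_of_mem_spanWithConst_range {W : ℕ} {G : Fin W → C(Set.Icc (0 : ℝ) 1, ℝ)}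
    {h : C(Set.Icc (0 : ℝ) 1, ℝ)} (hh : h ∈ spanWithConst (Set.range G)) :
    ∃ (c : Fin W → ℝ) (b : ℝ), ∀ t, h t = ∑ i, c i * G i t + b := by
  obtain ⟨b, z, hz, rfl⟩ := Submodule.mem_span_insert.1 hh
  obtain ⟨c, rfl⟩ := (Submodule.mem_span_range_iff_exists_fun ℝ).1 hz
  refine ⟨c, b, fun t => ?_⟩
  simp [ContinuousMap.sum_apply, add_comm]

/-- `IsHiddenLayer k G`: some `k` hidden layers of width `W` turn the input `t ∈ [0,1]` into the
vector `(G i t)ᵢ`. Networks are built from the input side inwards, so this is phrased by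
continuations: every network `rest` that starts from such a vector extends to one that starts
from `t`. -/
def IsHiddenLayer {W : ℕ} (k : ℕ) (G : Fin W → C(Set.Icc (0 : ℝ) 1, ℝ)) : Prop :=
  ∀ (j : ℕ) (rest : FCNetwork W (List.replicate j W) 1),
    ∃ N : FCNetwork 1 (List.replicate (k + j) W) 1,
      ∀ t : Set.Icc (0 : ℝ) 1, N.eval ReLU (fun _ => (t : ℝ)) = rest.eval ReLU (fun i => G i t)

theorem IsHiddenLayer.succ {W k : ℕ} {G G' : Fin W → C(Set.Icc (0 : ℝ) 1, ℝ)}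
    (hG : IsHiddenLayer k G)
    (h : ∀ i, ∃ g ∈ spanWithConst (Set.range G), G' i = reluMap g) : IsHiddenLayer (k + 1) G' := by
  choose g hg hG' using h
  choose c b hcb using fun i => exists_coeff_of_mem_spanWithConst_range (hg i)
  intro j rest
  obtain ⟨N, hN⟩ := hG (j + 1) (.hidden (Matrix.of c) b rest)
  rw [show k + 1 + j = k + (j + 1) by ring]
  refine ⟨N, fun t => (hN t).trans ?_⟩
  simp only [FCNetwork.eval]
  congr 1
  ext i
  rw [hG', reluMap_apply, hcb]
  simp [ReLU, Matrix.mulVec, dotProduct]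

theorem isHiddenLayer_one {W : ℕ} {G : Fin W → C(Set.Icc (0 : ℝ) 1, ℝ)}
    (h : ∀ i, ∃ a b : ℝ, ∀ t : Set.Icc (0 : ℝ) 1, G i t = max 0 (a * t + b)) :
    IsHiddenLayer 1 G := by
  choose a b hab using h
  intro j rest
  rw [show 1 + j = j + 1 by ring]
  refine ⟨.hidden (Matrix.of fun i _ => a i) b rest, fun t => ?_⟩
  simp only [FCNetwork.eval]
  congr 1
  ext i
  rw [hab]
  simp [ReLU, Matrix.mulVec, dotProduct]

/-- `IsRealized W k s`: there are `k` hidden layers of width `W` such that each function in `s` is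
an affine combination of the outputs of the last of them. -/
def IsRealized (W k : ℕ) (s : Set C(Set.Icc (0 : ℝ) 1, ℝ)) : Prop :=
  ∃ G : Fin W → C(Set.Icc (0 : ℝ) 1, ℝ), IsHiddenLayer k G ∧
    ∀ h ∈ s, h ∈ spanWithConst (Set.range G)

theorem IsRealized.mono {W k : ℕ} {s s' : Set C(Set.Icc (0 : ℝ) 1, ℝ)} (hs : IsRealized W k s)
    (h : ∀ f ∈ s', f ∈ spanWithConst s) : IsRealized W k s' := by
  obtain ⟨G, hG, hsG⟩ := hs
  exact ⟨G, hG, fun f hf => spanWithConst_le hsG (h f hf)⟩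

/-- A function on `[0,1]` is recovered, up to an additive constant, from a single neuron, since
adding a large constant makes it nonnegative. Hence a neuron can also carry a value of arbitrary
sign to the next layer. -/
theorem exists_reluMap_carry {s : Set C(Set.Icc (0 : ℝ) 1, ℝ)} {h : C(Set.Icc (0 : ℝ) 1, ℝ)}
    (hh : h ∈ spanWithConst s) :
    ∃ g ∈ spanWithConst s, h ∈ spanWithConst {reluMap g} := by
  refine ⟨h + ‖h‖ • 1, add_mem hh (Submodule.smul_mem _ _ (one_mem_spanWithConst s)), ?_⟩
  have : h = reluMap (h + ‖h‖ • 1) - ‖h‖ • 1 := by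
    ext t
    have := neg_le_of_abs_le ((Real.norm_eq_abs _) ▸ h.norm_coe_le_norm t)
    simp only [ContinuousMap.sub_apply, reluMap_apply, ContinuousMap.add_apply,
      ContinuousMap.smul_apply, ContinuousMap.one_apply, smul_eq_mul, mul_one]
    rw [max_eq_right (by linarith)]
    ring
  rw [this]
  exact sub_mem (mem_spanWithConst_self (by rw [← this]; rfl))
    (Submodule.smul_mem _ _ (one_mem_spanWithConst _))

/-- One more layer of width `W` computes up to `W` functions, each of which is an affine
combination of the functions at hand or the `ReLU` of one. -/
theorem IsRealized.succ {W k : ℕ} {s : Set C(Set.Icc (0 : ℝ) 1, ℝ)} (hs : IsRealized W k s)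
    (l : List C(Set.Icc (0 : ℝ) 1, ℝ)) (hl : l.length ≤ W)
    (h : ∀ f ∈ l, f ∈ spanWithConst s ∨ ∃ g ∈ spanWithConst s, reluMap g = f) :
    IsRealized W (k + 1) {f | f ∈ l} := by
  obtain ⟨G, hG, hsG⟩ := hs
  have key : ∀ f ∈ l, ∃ g ∈ spanWithConst s, f ∈ spanWithConst {reluMap g} := by
    intro f hf
    rcases h f hf with h | ⟨g, hg, rfl⟩
    · exact exists_reluMap_carry h
    · exact ⟨g, hg, mem_spanWithConst_self rfl⟩
  choose! g hg hfg using key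
  refine ⟨fun i => reluMap (if hi : (i : ℕ) < l.length then g l[i] else 0), hG.succ fun i => ?_,
    fun f hf => ?_⟩
  · refine ⟨_, ?_, rfl⟩
    split_ifs with hi
    · exact spanWithConst_le hsG (hg _ (List.getElem_mem hi))
    · exact zero_mem _
  · obtain ⟨i, hi, rfl⟩ := List.getElem_of_mem hf
    refine spanWithConst_le ?_ (hfg _ hf)
    rintro _ rfl
    exact mem_spanWithConst_self ⟨⟨i, hi.trans_le hl⟩, by simp [hi]⟩

theorem IsRealized.le {W k k' : ℕ} {l : List C(Set.Icc (0 : ℝ) 1, ℝ)} (hl : l.length ≤ W)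
    (hs : IsRealized W k {f | f ∈ l}) (hk : k ≤ k') : IsRealized W k' {f | f ∈ l} := by
  induction hk with
  | refl => exact hs
  | step _ ih => exact ih.succ l hl fun f hf => Or.inl (mem_spanWithConst_self hf)

theorem IsRealized.mem_upsilon {W k : ℕ} {s : Set C(Set.Icc (0 : ℝ) 1, ℝ)}
    (hs : IsRealized W k s) {h : C(Set.Icc (0 : ℝ) 1, ℝ)} (hh : h ∈ spanWithConst s) :
    h ∈ UpsilonReLUOnUnitInterval W k := by
  obtain ⟨G, hG, hsG⟩ := hs
  obtain ⟨c, b, hcb⟩ := exists_coeff_of_mem_spanWithConst_range (spanWithConst_le hsG hh)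
  obtain ⟨N, hN⟩ := hG 0 (.output (Matrix.of fun _ => c) fun _ => b)
  refine ⟨_, ⟨N, rfl⟩, fun t => ?_⟩
  rw [hN t, hcb]
  simp [FCNetwork.eval, Matrix.mulVec, dotProduct]

/-- The coordinate function `t ↦ t` on `[0,1]`. -/
def coordMap : C(Set.Icc (0 : ℝ) 1, ℝ) := ⟨Subtype.val, continuous_subtype_val⟩

theorem coordMap_apply (t : Set.Icc (0 : ℝ) 1) : coordMap t = t := rfl

theorem isRealized_coordMap {W : ℕ} (hW : 0 < W) : IsRealized W 1 {coordMap} := by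
  refine ⟨fun _ => coordMap, isHiddenLayer_one fun _ => ⟨1, 0, fun t => ?_⟩, ?_⟩
  · simp [coordMap_apply, t.2.1]
  · rintro _ rfl
    exact mem_spanWithConst_self ⟨⟨0, hW⟩, rfl⟩

/-! ### Sums of unit ramps -/

/-- The ramp that rises from `0` to `1` on `[0,1]`, as a difference of two rectified linear
units. -/
noncomputable def unitRamp (t : ℝ) : ℝ := max 0 t - max 0 (t - 1)

theorem unitRamp_of_nonpos {t : ℝ} (h : t ≤ 0) : unitRamp t = 0 := by
  rw [unitRamp, max_eq_left h, max_eq_left (by linarith), sub_zero]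

theorem unitRamp_of_one_le {t : ℝ} (h : 1 ≤ t) : unitRamp t = 1 := by
  rw [unitRamp, max_eq_right (by linarith), max_eq_right (by linarith), sub_sub_cancel]

theorem unitRamp_of_mem {t : ℝ} (h₀ : 0 ≤ t) (h₁ : t ≤ 1) : unitRamp t = t := by
  rw [unitRamp, max_eq_right h₀, max_eq_left (by linarith), sub_zero]

theorem sum_range_mul_of_eq_one_of_eq_zero {c s : ℕ → ℝ} {m N : ℕ} (hm : m < N)
    (h₁ : ∀ i < m, s i = 1) (h₀ : ∀ i, m < i → s i = 0) :
    ∑ i ∈ Finset.range N, c i * s i = ∑ i ∈ Finset.range m, c i + c m * s m := by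
  rw [← Finset.sum_subset (Finset.range_subset_range.2 (Nat.succ_le_of_lt hm)),
    Finset.sum_range_succ]
  · congr 1
    exact Finset.sum_congr rfl fun i hi => by rw [h₁ i (Finset.mem_range.1 hi), mul_one]
  · intro i _ hi
    rw [h₀ i (by simpa using hi), mul_zero]

theorem unitRamp_mem (t : ℝ) : 0 ≤ unitRamp t ∧ unitRamp t ≤ 1 := by
  rcases le_total t 0 with h₀ | h₀
  · simp [unitRamp_of_nonpos h₀]
  rcases le_total t 1 with h₁ | h₁
  · rw [unitRamp_of_mem h₀ h₁]; exact ⟨h₀, h₁⟩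
  · simp [unitRamp_of_one_le h₁]

/-- `∑ cⱼ unitRamp (u - j)` is the continuous piecewise linear function of `u` that vanishes at `0`
and has slope `cⱼ` on `[j, j+1]`. -/
theorem sum_mul_unitRamp {c : ℕ → ℝ} {m N : ℕ} (hm : m < N) {u : ℝ} (h₀ : (m : ℝ) ≤ u)
    (h₁ : u ≤ m + 1) :
    ∑ j ∈ Finset.range N, c j * unitRamp (u - j) = ∑ j ∈ Finset.range m, c j + c m * (u - m) := by
  rw [sum_range_mul_of_eq_one_of_eq_zero hm, unitRamp_of_mem (by linarith) (by linarith)]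
  · intro i hi
    have : (i : ℝ) + 1 ≤ m := by exact_mod_cast hi
    exact unitRamp_of_one_le (by linarith)
  · intro i hi
    have : (m : ℝ) + 1 ≤ i := by exact_mod_cast hi
    exact unitRamp_of_nonpos (by linarith)

/-- A sum of steep ramps, of width `1/M` and ending at the integers, is constant away from these
ramps. -/
theorem sum_mul_steep_unitRamp {c : ℕ → ℝ} {m N : ℕ} {M : ℝ} (hM : 0 < M) (hm : m < N) {y : ℝ}
    (h₀ : (m : ℝ) ≤ y) (h₁ : M * (y - (m + 1)) + 1 ≤ 0) :
    ∑ i ∈ Finset.range N, c i * unitRamp (M * (y - (i + 1)) + 1) = ∑ i ∈ Finset.range m, c i := by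
  rw [sum_range_mul_of_eq_one_of_eq_zero hm, unitRamp_of_nonpos h₁, mul_zero, add_zero]
  · intro i hi
    have : (i : ℝ) + 1 ≤ m := by exact_mod_cast hi
    refine unitRamp_of_one_le ?_
    nlinarith [mul_nonneg hM.le (show 0 ≤ y - (i + 1) by linarith)]
  · intro i hi
    have : (m : ℝ) + 1 ≤ i := by exact_mod_cast hi
    refine unitRamp_of_nonpos ?_
    nlinarith [mul_nonneg hM.le (show 0 ≤ (i : ℝ) - m by linarith)]

/-- The tent on `[0,1]` of height `1/2`, which is the distance to the endpoints there. -/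
noncomputable def tent (t : ℝ) : ℝ := max 0 t - 2 * max 0 (t - 1 / 2) + max 0 (t - 1)

theorem tent_eq_zero {t : ℝ} (h : t ≤ 0 ∨ 1 ≤ t) : tent t = 0 := by
  rcases h with h | h
  · rw [tent, max_eq_left h, max_eq_left (by linarith), max_eq_left (by linarith)]; ring
  · rw [tent, max_eq_right (by linarith), max_eq_right (by linarith), max_eq_right (by linarith)]
    ring

theorem tent_eq_min {t : ℝ} (h₀ : 0 ≤ t) (h₁ : t ≤ 1) : tent t = min t (1 - t) := by
  rw [tent, max_eq_right h₀, max_eq_left (a := 0) (b := t - 1) (by linarith)]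
  rcases le_total t (1 / 2) with h | h
  · rw [max_eq_left (by linarith), min_eq_left (by linarith)]; ring
  · rw [max_eq_right (by linarith), min_eq_right (by linarith)]; ring

theorem sum_tent {m N : ℕ} (hm : m < N) {y : ℝ} (h₀ : (m : ℝ) ≤ y) (h₁ : y ≤ m + 1) :
    ∑ i ∈ Finset.range N, tent (y - i) = min (y - m) (m + 1 - y) := by
  rw [Finset.sum_eq_single_of_mem m (Finset.mem_range.2 hm),
    tent_eq_min (by linarith) (by linarith)]
  · congr 1; ring
  · intro i _ hi
    refine tent_eq_zero ?_
    rcases lt_or_gt_of_ne hi with hi | hi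
    · have : (i : ℝ) + 1 ≤ m := by exact_mod_cast hi
      right; linarith
    · have : (m : ℝ) + 1 ≤ i := by exact_mod_cast hi
      left; linarith

/-! ### Coding a sequence of bits in one real number -/

/-- The number with ternary expansion `0.b₀b₁…b_{M-1}`. -/
noncomputable def ternaryCode : ℕ → (ℕ → ℝ) → ℝ
  | 0, _ => 0
  | M + 1, b => (b 0 + ternaryCode M fun j => b (j + 1)) / 3

theorem ternaryCode_mem {b : ℕ → ℝ} (hb : ∀ j, b j = 0 ∨ b j = 1) (M : ℕ) :
    0 ≤ ternaryCode M b ∧ ternaryCode M b ≤ 1 / 2 := by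
  induction M generalizing b with
  | zero => norm_num [ternaryCode]
  | succ M ih =>
    have h := ih fun j => hb (j + 1)
    rw [ternaryCode]
    rcases hb 0 with h0 | h0 <;> rw [h0] <;> constructor <;> linarith [h.1, h.2]

/-- The digits of a ternary number without digit `2` leave a gap between `1/6` and `1/3`, so that
a continuous piecewise linear function can read off the first digit. -/
theorem unitRamp_ternaryCode {b : ℕ → ℝ} (hb : ∀ j, b j = 0 ∨ b j = 1) (M : ℕ) :
    unitRamp (6 * ternaryCode (M + 1) b - 1) = b 0 := by
  have h := ternaryCode_mem (fun j => hb (j + 1)) M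
  rw [ternaryCode]
  rcases hb 0 with h0 | h0 <;> rw [h0]
  · exact unitRamp_of_nonpos (by linarith)
  · exact unitRamp_of_one_le (by linarith)

theorem unitRamp_of_decoding {b d : ℕ → ℝ} {M : ℕ} (hb : ∀ j, b j = 0 ∨ b j = 1)
    (hd₀ : d 0 = ternaryCode M b) (hd : ∀ j, d (j + 1) = 3 * d j - unitRamp (6 * d j - 1))
    {j : ℕ} (hj : j < M) : unitRamp (6 * d j - 1) = b j := by
  have key : ∀ j ≤ M, d j = ternaryCode (M - j) fun i => b (i + j) := by
    intro j
    induction j with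
    | zero => exact fun _ => hd₀
    | succ j ih =>
      intro hj
      obtain ⟨k, rfl⟩ := Nat.exists_eq_add_of_lt hj
      have h := ih (by omega)
      rw [show j + k + 1 - j = k + 1 by omega] at h
      rw [hd, h, unitRamp_ternaryCode (fun i => hb _), ternaryCode,
        show j + k + 1 - (j + 1) = k by omega]
      simp only [zero_add, add_assoc, add_comm 1 j]
      ring
  obtain ⟨k, rfl⟩ := Nat.exists_eq_add_of_lt hj
  rw [key j hj.le, show j + k + 1 - j = k + 1 by omega, unitRamp_ternaryCode (fun i => hb _),
    zero_add]

/-- A sequence with increments at most `h` stays within `2h` of some sequence with increments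
`±h`: step up exactly when not above the target. -/
theorem exists_bits_tracking {a : ℕ → ℝ} {h : ℝ} (h₀ : a 0 = 0)
    (ha : ∀ j, |a (j + 1) - a j| ≤ h) :
    ∃ b : ℕ → ℝ, (∀ j, b j = 0 ∨ b j = 1) ∧
      ∀ m, |a m - ∑ j ∈ Finset.range m, h * (2 * b j - 1)| ≤ 2 * h := by
  obtain ⟨p, hp₀, hp⟩ : ∃ p : ℕ → ℝ, p 0 = 0 ∧
      ∀ j, p (j + 1) = p j + if p j ≤ a j then h else -h :=
    ⟨fun j => Nat.rec 0 (fun j q => q + if q ≤ a j then h else -h) j, rfl, fun _ => rfl⟩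
  refine ⟨fun j => if p j ≤ a j then 1 else 0, fun j => by dsimp only; split_ifs <;> simp,
    fun m => ?_⟩
  have hsum : ∑ j ∈ Finset.range m, h * (2 * (if p j ≤ a j then 1 else 0 : ℝ) - 1) = p m := by
    induction m with
    | zero => exact hp₀.symm
    | succ m ih =>
      rw [Finset.sum_range_succ, ih, hp]
      split_ifs <;> ring
  rw [hsum]
  clear hsum
  induction m with
  | zero =>
    have := (abs_nonneg _).trans (ha 0)
    simpa [h₀, hp₀] using this
  | succ m ih =>
    have h1 := abs_le.1 (ha m)
    have h2 := abs_le.1 ih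
    rw [hp, abs_le]
    split_ifs with hc <;> constructor <;> linarith

/-! ### The residual of piecewise linear interpolation -/

/-- The value at `y` of the affine function that agrees with `φ` at `m` and `m + 1`. -/
noncomputable def chord (φ : ℝ → ℝ) (m : ℕ) (y : ℝ) : ℝ := φ m + (φ (m + 1) - φ m) * (y - m)

theorem abs_chord_slope_le {φ : ℝ → ℝ} (hφ : ∀ s t, |φ s - φ t| ≤ |s - t|) (m : ℕ) :
    |φ (m + 1) - φ m| ≤ 1 := by
  simpa using hφ (m + 1) m

theorem abs_residual_sub_le {φ : ℝ → ℝ} (hφ : ∀ s t, |φ s - φ t| ≤ |s - t|) (m : ℕ) (y z : ℝ) :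
    |(φ y - chord φ m y) - (φ z - chord φ m z)| ≤ 2 * |y - z| := by
  have h1 := hφ y z
  have h2 := mul_le_mul_of_nonneg_right (abs_chord_slope_le hφ m) (abs_nonneg (y - z))
  rw [← abs_mul] at h2
  calc _ = |(φ y - φ z) - (φ (m + 1) - φ m) * (y - z)| := by rw [chord, chord]; congr 1; ring
    _ ≤ _ := (abs_sub _ _).trans (by linarith)

/-- The residual vanishes at both ends of `[m, m+1]` and is `2`-Lipschitz. -/
theorem abs_residual_le {φ : ℝ → ℝ} (hφ : ∀ s t, |φ s - φ t| ≤ |s - t|) {m : ℕ} {y : ℝ}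
    (h₀ : (m : ℝ) ≤ y) (h₁ : y ≤ m + 1) :
    |φ y - chord φ m y| ≤ 2 * min (y - m) (m + 1 - y) := by
  have e0 : φ m - chord φ m m = 0 := by rw [chord]; ring
  have e1 : φ (m + 1) - chord φ m (m + 1) = 0 := by rw [chord]; ring
  have a0 := abs_residual_sub_le hφ m y m
  have a1 := abs_residual_sub_le hφ m y (m + 1)
  rw [e0, sub_zero, abs_of_nonneg (sub_nonneg.2 h₀)] at a0
  rw [e1, sub_zero, abs_sub_comm y, abs_of_nonneg (sub_nonneg.2 h₁)] at a1
  rw [mul_min_of_nonneg _ _ (by norm_num)]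
  exact le_min a0 a1

/-- Bits for the interval `[m, m+1]`: the polygon with slopes `±2` that they describe is within
`8/M` of the residual. -/
theorem exists_bits_residual {φ : ℝ → ℝ} (hφ : ∀ s t, |φ s - φ t| ≤ |s - t|) {M : ℕ} (hM : 0 < M)
    (m : ℕ) :
    ∃ b : ℕ → ℝ, (∀ j, b j = 0 ∨ b j = 1) ∧ ∀ y : ℝ, (m : ℝ) ≤ y → y < m + 1 →
      |(φ y - chord φ m y) -
        ∑ j ∈ Finset.range M, 2 / M * (2 * b j - 1) * unitRamp (M * (y - m) - j)| ≤ 8 / M := by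
  have hM' : (0 : ℝ) < M := by exact_mod_cast hM
  obtain ⟨b, hb, hab⟩ := exists_bits_tracking
    (a := fun j : ℕ => φ (m + j / M) - chord φ m (m + j / M)) (h := 2 / M)
    (by simp [chord]) (fun j => by
      refine (abs_residual_sub_le hφ m _ _).trans_eq ?_
      rw [show (m : ℝ) + ((j + 1 : ℕ) : ℝ) / M - (m + j / M) = 1 / M by push_cast; ring,
        abs_of_pos (by positivity)]
      ring)
  refine ⟨b, hb, fun y h₀ h₁ => ?_⟩
  set u := M * (y - m) with hu
  have hu0 : 0 ≤ u := mul_nonneg hM'.le (by linarith)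
  have huM : u < M := by nlinarith
  have hkM : ⌊u⌋₊ < M := (Nat.floor_lt hu0).2 huM
  have hk0 := Nat.floor_le hu0
  have hk1 := (Nat.lt_floor_add_one u).le
  rw [sum_mul_unitRamp hkM hk0 hk1]
  set k := ⌊u⌋₊
  have hy : y - (m + k / M) = (u - k) / M := by rw [hu]; field_simp; ring
  have e1 := abs_residual_sub_le hφ m y (m + k / M)
  rw [hy, abs_of_nonneg (div_nonneg (by linarith) hM'.le)] at e1
  have e2 := hab k
  have e3 : |2 / M * (2 * b k - 1) * (u - k)| ≤ 2 / M := by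
    rw [abs_mul, abs_mul, abs_of_pos (show (0 : ℝ) < 2 / M by positivity),
      abs_of_nonneg (show 0 ≤ u - k by linarith)]
    have : |2 * b k - 1| = 1 := by rcases hb k with h | h <;> norm_num [h]
    rw [this, mul_one]
    exact mul_le_of_le_one_right (by positivity) (by linarith)
  have e4 : 2 * ((u - k) / M) ≤ 2 / M := by
    rw [← mul_div_assoc]
    exact div_le_div_of_nonneg_right (by linarith) hM'.le
  have e5 : (8 : ℝ) / M = 4 * (2 / M) := by ring
  rw [e5]
  rw [abs_le] at *
  constructor <;> linarith [e1.1, e1.2, e2.1, e2.2, e3.1, e3.2]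

/-! ### Truncation -/

/-- Truncation of `g` to `[-D, D]`, written with rectified linear units; it does not increase the
distance to a point of `[-D, D]`. -/
theorem abs_sub_truncation_le {v g D : ℝ} (hv : |v| ≤ D) :
    |v - (max 0 (g + D) - max 0 (g - D) - D)| ≤ min |v - g| (2 * D) := by
  have := abs_le.1 hv
  rcases le_total 0 (g + D) with h1 | h1 <;> rcases le_total 0 (g - D) with h2 | h2 <;>
    simp only [h1, h2, max_eq_left, max_eq_right] <;> refine le_min ?_ ?_ <;>
    rcases abs_cases (v - g) with h3 | h3 <;> rw [abs_le] <;> constructor <;> linarith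

/-! ### The network -/

/-- `unitRamp ∘ h`, as a combination of two neurons. -/
noncomputable def rampMap (h : C(Set.Icc (0 : ℝ) 1, ℝ)) : C(Set.Icc (0 : ℝ) 1, ℝ) :=
  reluMap h - reluMap (h - 1)

theorem rampMap_apply (h : C(Set.Icc (0 : ℝ) 1, ℝ)) (t : Set.Icc (0 : ℝ) 1) :
    rampMap h t = unitRamp (h t) := rfl

/-- `tent ∘ h`, as a combination of three neurons. -/
noncomputable def tentMap (h : C(Set.Icc (0 : ℝ) 1, ℝ)) : C(Set.Icc (0 : ℝ) 1, ℝ) :=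
  reluMap h - (2 : ℝ) • reluMap (h - (1 / 2 : ℝ) • 1) + reluMap (h - 1)

theorem tentMap_apply (h : C(Set.Icc (0 : ℝ) 1, ℝ)) (t : Set.Icc (0 : ℝ) 1) :
    tentMap h t = tent (h t) := by
  simp [tentMap, tent, reluMap_apply]

/-- The steep ramp in the variable `Y` that rises on `[i + 1 - 1/M, i + 1]`. -/
noncomputable def steepMap (M : ℝ) (Y : C(Set.Icc (0 : ℝ) 1, ℝ)) (i : ℕ) :
    C(Set.Icc (0 : ℝ) 1, ℝ) :=
  rampMap (M • (Y - (i + 1 : ℝ) • 1) + 1)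

theorem steepMap_apply (M : ℝ) (Y : C(Set.Icc (0 : ℝ) 1, ℝ)) (i : ℕ) (t : Set.Icc (0 : ℝ) 1) :
    steepMap M Y i t = unitRamp (M * (Y t - (i + 1)) + 1) := by
  simp [steepMap, rampMap_apply]

/-- Four sums, two of steep ramps, one of unit ramps and one of tents, accumulated in parallel at
the cost of one layer per term. -/
theorem isRealized_sums {k₀ : ℕ} {Y : C(Set.Icc (0 : ℝ) 1, ℝ)} (hY : IsRealized 11 k₀ {Y})
    (M : ℝ) (c d : ℕ → ℝ) (k : ℕ) :
    IsRealized 11 (k₀ + k) {f | f ∈ [Y, ∑ i ∈ Finset.range k, steepMap M Y i,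
      ∑ i ∈ Finset.range k, c i • steepMap M Y i,
      ∑ i ∈ Finset.range k, d i • rampMap (Y - (i : ℝ) • 1),
      ∑ i ∈ Finset.range k, tentMap (Y - (i : ℝ) • 1)]} := by
  induction k with
  | zero =>
    refine hY.mono ?_
    simp only [Set.mem_ofPred_eq, List.forall_mem_cons, Finset.range_zero, Finset.sum_empty,
      zero_mem, List.not_mem_nil, false_imp_iff, implies_true, and_true]
    exact mem_spanWithConst_self rfl
  | succ k ih =>
    simp only [Finset.sum_range_succ]
    set S := ∑ i ∈ Finset.range k, steepMap M Y i
    set U := ∑ i ∈ Finset.range k, c i • steepMap M Y i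
    set P := ∑ i ∈ Finset.range k, d i • rampMap (Y - (i : ℝ) • 1)
    set T := ∑ i ∈ Finset.range k, tentMap (Y - (i : ℝ) • 1)
    set y := Y - (k : ℝ) • (1 : C(Set.Icc (0 : ℝ) 1, ℝ)) with hy
    set z := M • (Y - (k + 1 : ℝ) • (1 : C(Set.Icc (0 : ℝ) 1, ℝ))) + 1 with hz
    refine (ih.succ [Y, S, U, P, T, reluMap y, reluMap (y - 1), reluMap (y - (1 / 2 : ℝ) • 1),
      reluMap z, reluMap (z - 1)] (by simp) ?_).mono ?_
    · set A := spanWithConst {f | f ∈ [Y, S, U, P, T]}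
      have h1 : 1 ∈ A := one_mem_spanWithConst _
      have hYA : Y ∈ A := mem_spanWithConst_self (by simp)
      have hyA : y ∈ A := A.sub_mem hYA (A.smul_mem _ h1)
      have hzA : z ∈ A := A.add_mem (A.smul_mem _ (A.sub_mem hYA (A.smul_mem _ h1))) h1
      simp only [List.forall_mem_cons, List.not_mem_nil, false_imp_iff, implies_true, and_true]
      exact ⟨Or.inl hYA, Or.inl (mem_spanWithConst_self (by simp)),
        Or.inl (mem_spanWithConst_self (by simp)), Or.inl (mem_spanWithConst_self (by simp)),
        Or.inl (mem_spanWithConst_self (by simp)), Or.inr ⟨_, hyA, rfl⟩,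
        Or.inr ⟨_, A.sub_mem hyA h1, rfl⟩, Or.inr ⟨_, A.sub_mem hyA (A.smul_mem _ h1), rfl⟩,
        Or.inr ⟨_, hzA, rfl⟩, Or.inr ⟨_, A.sub_mem hzA h1, rfl⟩⟩
    · set A := spanWithConst {f | f ∈ [Y, S, U, P, T, reluMap y, reluMap (y - 1),
        reluMap (y - (1 / 2 : ℝ) • 1), reluMap z, reluMap (z - 1)]}
      have hramp : rampMap y ∈ A := A.sub_mem (mem_spanWithConst_self (by simp))
        (mem_spanWithConst_self (by simp))
      have htent : tentMap y ∈ A := A.add_mem (A.sub_mem (mem_spanWithConst_self (by simp))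
        (A.smul_mem _ (mem_spanWithConst_self (by simp)))) (mem_spanWithConst_self (by simp))
      have hsteep : steepMap M Y k ∈ A := A.sub_mem (mem_spanWithConst_self (by simp [hz]))
        (mem_spanWithConst_self (by simp [hz]))
      simp only [Set.mem_ofPred_eq, List.forall_mem_cons, List.not_mem_nil,
        false_imp_iff, implies_true, and_true]
      exact ⟨mem_spanWithConst_self (by simp),
        A.add_mem (mem_spanWithConst_self (by simp)) hsteep,
        A.add_mem (mem_spanWithConst_self (by simp)) (A.smul_mem _ hsteep),
        A.add_mem (mem_spanWithConst_self (by simp)) (A.smul_mem _ hramp),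
        A.add_mem (mem_spanWithConst_self (by simp)) htent⟩

/-- What is left of the ternary code `θ` after its first `j` digits have been read off. -/
noncomputable def remainderMap (θ : C(Set.Icc (0 : ℝ) 1, ℝ)) : ℕ → C(Set.Icc (0 : ℝ) 1, ℝ)
  | 0 => θ
  | j + 1 => (3 : ℝ) • remainderMap θ j - rampMap ((6 : ℝ) • remainderMap θ j - 1)

/-- The polygon in the variable `u` whose increment over `[j, j+1]` is `h` or `-h` according to
the `j`-th digit of `θ`. The product of a digit `b ∈ {0, 1}` and a ramp value `r ∈ [0,1]` is
`ReLU (r + b - 1)`. -/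
noncomputable def polygonMap (h : ℝ) (θ u : C(Set.Icc (0 : ℝ) 1, ℝ)) (k : ℕ) :
    C(Set.Icc (0 : ℝ) 1, ℝ) :=
  ∑ j ∈ Finset.range k, ((2 * h) • reluMap (rampMap (u - (j : ℝ) • 1) +
    rampMap ((6 : ℝ) • remainderMap θ j - 1) - 1) - h • rampMap (u - (j : ℝ) • 1))

/-- Two layers read off one digit and add the corresponding piece of the polygon. -/
theorem isRealized_polygonMap {k₀ : ℕ} {θ u P T : C(Set.Icc (0 : ℝ) 1, ℝ)}
    (hs : IsRealized 11 k₀ {f | f ∈ [θ, u, P, T]}) (h : ℝ) (k : ℕ) :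
    IsRealized 11 (k₀ + 2 * k) {f | f ∈ [remainderMap θ k, polygonMap h θ u k, u, P, T]} := by
  induction k with
  | zero =>
    refine hs.mono ?_
    simp only [Set.mem_ofPred_eq, List.forall_mem_cons, polygonMap, Finset.range_zero,
      Finset.sum_empty, zero_mem, true_and, List.not_mem_nil, false_imp_iff, implies_true,
      and_true, remainderMap]
    exact ⟨mem_spanWithConst_self (by simp), mem_spanWithConst_self (by simp),
      mem_spanWithConst_self (by simp), mem_spanWithConst_self (by simp)⟩
  | succ k ih =>
    rw [polygonMap, Finset.sum_range_succ, ← polygonMap, remainderMap]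
    set d := remainderMap θ k
    set g := polygonMap h θ u k
    set r := u - (k : ℝ) • (1 : C(Set.Icc (0 : ℝ) 1, ℝ))
    set e := (6 : ℝ) • d - 1
    refine ((ih.succ [d, g, u, P, T, reluMap r, reluMap (r - 1), reluMap e, reluMap (e - 1)]
      (by simp) ?_).succ [(3 : ℝ) • d - rampMap e, g - h • rampMap r, u, P, T,
        reluMap (rampMap r + rampMap e - 1)] (by simp) ?_).mono ?_
    · set A := spanWithConst {f | f ∈ [d, g, u, P, T]}
      have h1 : 1 ∈ A := one_mem_spanWithConst _
      have hr : r ∈ A := A.sub_mem (mem_spanWithConst_self (by simp)) (A.smul_mem _ h1)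
      have he : e ∈ A := A.sub_mem (A.smul_mem _ (mem_spanWithConst_self (by simp))) h1
      simp only [List.forall_mem_cons, List.not_mem_nil, false_imp_iff, implies_true, and_true]
      exact ⟨Or.inl (mem_spanWithConst_self (by simp)), Or.inl (mem_spanWithConst_self (by simp)),
        Or.inl (mem_spanWithConst_self (by simp)), Or.inl (mem_spanWithConst_self (by simp)),
        Or.inl (mem_spanWithConst_self (by simp)), Or.inr ⟨_, hr, rfl⟩,
        Or.inr ⟨_, A.sub_mem hr h1, rfl⟩, Or.inr ⟨_, he, rfl⟩, Or.inr ⟨_, A.sub_mem he h1, rfl⟩⟩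
    · set A := spanWithConst {f | f ∈ [d, g, u, P, T, reluMap r, reluMap (r - 1), reluMap e,
        reluMap (e - 1)]}
      have hr : rampMap r ∈ A := A.sub_mem (mem_spanWithConst_self (by simp))
        (mem_spanWithConst_self (by simp))
      have he : rampMap e ∈ A := A.sub_mem (mem_spanWithConst_self (by simp))
        (mem_spanWithConst_self (by simp))
      simp only [List.forall_mem_cons, List.not_mem_nil, false_imp_iff, implies_true, and_true]
      exact ⟨Or.inl (A.sub_mem (A.smul_mem _ (mem_spanWithConst_self (by simp))) he),
        Or.inl (A.sub_mem (mem_spanWithConst_self (by simp)) (A.smul_mem _ hr)),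
        Or.inl (mem_spanWithConst_self (by simp)), Or.inl (mem_spanWithConst_self (by simp)),
        Or.inl (mem_spanWithConst_self (by simp)),
        Or.inr ⟨_, A.sub_mem (A.add_mem hr he) (one_mem_spanWithConst _), rfl⟩⟩
    · set A := spanWithConst {f | f ∈ [(3 : ℝ) • d - rampMap e, g - h • rampMap r, u, P, T,
        reluMap (rampMap r + rampMap e - 1)]}
      simp only [Set.mem_ofPred_eq, List.forall_mem_cons, List.not_mem_nil,
        false_imp_iff, implies_true, and_true]
      refine ⟨mem_spanWithConst_self (by simp), ?_, mem_spanWithConst_self (by simp),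
        mem_spanWithConst_self (by simp), mem_spanWithConst_self (by simp)⟩
      rw [← add_sub_assoc, add_sub_right_comm]
      exact A.add_mem (mem_spanWithConst_self (by simp))
        (A.smul_mem _ (mem_spanWithConst_self (by simp)))

/-- Where `θ` takes as value the code of a bit sequence `b`, the polygon is the one described by
`b`. -/
theorem polygonMap_apply {b : ℕ → ℝ} (hb : ∀ j, b j = 0 ∨ b j = 1) (h : ℝ) {M : ℕ}
    {θ u : C(Set.Icc (0 : ℝ) 1, ℝ)} {t : Set.Icc (0 : ℝ) 1} (hθ : θ t = ternaryCode M b) :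
    polygonMap h θ u M t =
      ∑ j ∈ Finset.range M, h * (2 * b j - 1) * unitRamp (u t - j) := by
  rw [polygonMap, ContinuousMap.sum_apply]
  refine Finset.sum_congr rfl fun j hj => ?_
  have hd := unitRamp_of_decoding (d := fun j => remainderMap θ j t) hb hθ
    (fun j => by simp [remainderMap, rampMap_apply]) (Finset.mem_range.1 hj)
  have hr : rampMap (u - (j : ℝ) • 1) t = unitRamp (u t - j) := by simp [rampMap_apply]
  have he : rampMap ((6 : ℝ) • remainderMap θ j - 1) t = b j := by simpa [rampMap_apply] using hd
  simp only [ContinuousMap.sub_apply, ContinuousMap.smul_apply, reluMap_apply,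
    ContinuousMap.add_apply, ContinuousMap.one_apply, hr, he, smul_eq_mul]
  have hr₀ := unitRamp_mem (u t - j)
  rcases hb j with h0 | h0 <;> rw [h0]
  · rw [max_eq_left (by linarith [hr₀.2])]; ring
  · rw [max_eq_right (by linarith [hr₀.1])]; ring

/-- Approximation of a `1`-Lipschitz function on `[0,N]`, in the rescaled variable `N t`. -/
theorem exists_upsilon_approx {φ : ℝ → ℝ} (hφ : ∀ s t, |φ s - φ t| ≤ |s - t|) {N M k : ℕ}
    (hN : 0 < N) (hM : 0 < M) (hk : N + 2 * M + 2 ≤ k) :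
    ∃ g ∈ UpsilonReLUOnUnitInterval 11 k, ∀ t : Set.Icc (0 : ℝ) 1,
      |φ (N * t) / N - g t| ≤ 8 / (M * N) := by
  have hM' : (0 : ℝ) < M := by exact_mod_cast hM
  have hN' : (0 : ℝ) < N := by exact_mod_cast hN
  choose b hb hbφ using exists_bits_residual hφ hM
  set code : ℕ → ℝ := fun m => ternaryCode M (b m) with hcode
  set Y := (N : ℝ) • coordMap with hY
  set S := ∑ i ∈ Finset.range N, steepMap M Y i with hS
  set U := ∑ i ∈ Finset.range N, (code (i + 1) - code i) • steepMap M Y i with hU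
  set P := ∑ i ∈ Finset.range N, (φ (i + 1) - φ i) • rampMap (Y - (i : ℝ) • 1) with hP
  set T := ∑ i ∈ Finset.range N, tentMap (Y - (i : ℝ) • 1) with hT
  set θ := U + code 0 • (1 : C(Set.Icc (0 : ℝ) 1, ℝ)) with hθ
  set u := (M : ℝ) • (Y - S) with hu
  set g := polygonMap (2 / M) θ u M with hg
  have real₁ : IsRealized 11 (1 + N) {f | f ∈ [Y, S, U, P, T]} := by
    refine isRealized_sums ((isRealized_coordMap (by norm_num)).mono ?_) M
      (fun i => code (i + 1) - code i) (fun i => φ (i + 1) - φ i) N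
    rintro _ rfl
    exact Submodule.smul_mem _ _ (mem_spanWithConst_self rfl)
  have real₂ : IsRealized 11 (1 + N + 2 * M) {f | f ∈ [remainderMap θ M, g, u, P, T]} := by
    refine isRealized_polygonMap (real₁.mono ?_) _ _
    set A := spanWithConst {f | f ∈ [Y, S, U, P, T]}
    simp only [Set.mem_ofPred_eq, List.forall_mem_cons, List.not_mem_nil, false_imp_iff,
      implies_true, and_true]
    exact ⟨A.add_mem (mem_spanWithConst_self (by simp))
      (A.smul_mem _ (one_mem_spanWithConst _)), A.smul_mem _ (A.sub_mem
      (mem_spanWithConst_self (by simp)) (mem_spanWithConst_self (by simp))),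
      mem_spanWithConst_self (by simp), mem_spanWithConst_self (by simp)⟩
  have real₃ : IsRealized 11 (1 + N + 2 * M + 1) {f | f ∈ [P, T, reluMap (g + (2 : ℝ) • T),
      reluMap (g - (2 : ℝ) • T)]} := by
    refine real₂.succ _ (by simp) ?_
    set A := spanWithConst {f | f ∈ [remainderMap θ M, g, u, P, T]}
    have hgA : g ∈ A := mem_spanWithConst_self (by simp)
    have hTA : T ∈ A := mem_spanWithConst_self (by simp)
    simp only [List.forall_mem_cons, List.not_mem_nil, false_imp_iff, implies_true, and_true]
    exact ⟨Or.inl (mem_spanWithConst_self (by simp)), Or.inl hTA,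
      Or.inr ⟨_, A.add_mem hgA (A.smul_mem _ hTA), rfl⟩,
      Or.inr ⟨_, A.sub_mem hgA (A.smul_mem _ hTA), rfl⟩⟩
  refine ⟨(N : ℝ)⁻¹ • (P + φ 0 • 1 +
    (reluMap (g + (2 : ℝ) • T) - reluMap (g - (2 : ℝ) • T) - (2 : ℝ) • T)),
    (real₃.le (by simp) (by omega : _ ≤ k)).mem_upsilon ?_, fun t => ?_⟩
  · set A := spanWithConst {f | f ∈ [P, T, reluMap (g + (2 : ℝ) • T), reluMap (g - (2 : ℝ) • T)]}
    exact A.smul_mem _ (A.add_mem (A.add_mem (mem_spanWithConst_self (by simp))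
      (A.smul_mem _ (one_mem_spanWithConst _))) (A.sub_mem (A.sub_mem
      (mem_spanWithConst_self (by simp)) (mem_spanWithConst_self (by simp)))
      (A.smul_mem _ (mem_spanWithConst_self (by simp)))))
  set y := (N : ℝ) * t with hy
  have hYt : Y t = y := rfl
  have hy₀ : 0 ≤ y := mul_nonneg hN'.le t.2.1
  have hyN : y ≤ N := mul_le_of_le_one_right hN'.le t.2.2
  -- The right endpoint `y = N` belongs to the last interval.
  obtain ⟨m, hm, hm₀, hm₁⟩ : ∃ m < N, (m : ℝ) ≤ y ∧ y ≤ m + 1 := by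
    rcases hyN.lt_or_eq with h | h
    · exact ⟨⌊y⌋₊, (Nat.floor_lt hy₀).2 h, Nat.floor_le hy₀, (Nat.lt_floor_add_one y).le⟩
    · obtain ⟨m, rfl⟩ := Nat.exists_eq_add_of_lt hN
      push_cast at h
      exact ⟨m, by omega, by linarith, by linarith⟩
  have hPt : P t + φ 0 = chord φ m y := by
    have h1 := sum_mul_unitRamp (c := fun i => φ (i + 1) - φ i) hm hm₀ hm₁
    have h2 := Finset.sum_range_sub (fun i : ℕ => φ i) m
    simp only [Nat.cast_add, Nat.cast_one, Nat.cast_zero] at h2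
    simp only [hP, ContinuousMap.sum_apply, ContinuousMap.smul_apply, rampMap_apply,
      ContinuousMap.sub_apply, ContinuousMap.one_apply, smul_eq_mul, mul_one, hYt, h1, h2, chord]
    ring
  have hTt : T t = min (y - m) (m + 1 - y) := by
    simp only [hT, ContinuousMap.sum_apply, tentMap_apply, ContinuousMap.sub_apply,
      ContinuousMap.smul_apply, ContinuousMap.one_apply, smul_eq_mul, mul_one, hYt,
      sum_tent hm hm₀ hm₁]
  have hres := abs_residual_le hφ hm₀ hm₁
  rw [← hTt] at hres
  have htrunc := abs_sub_truncation_le (g := g t) hres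
  have key : |φ y - chord φ m y - (max 0 (g t + 2 * T t) - max 0 (g t - 2 * T t) - 2 * T t)|
      ≤ 8 / M := by
    rcases le_total (M * (y - (m + 1)) + 1) 0 with h | h
    · refine (htrunc.trans (min_le_left _ _)).trans ?_
      have hθt : θ t = code m := by
        have h1 := sum_mul_steep_unitRamp (c := fun i => code (i + 1) - code i) hM' hm hm₀ h
        simp only [hθ, hU, ContinuousMap.add_apply, ContinuousMap.sum_apply,
          ContinuousMap.smul_apply, steepMap_apply, ContinuousMap.one_apply, smul_eq_mul, mul_one,
          hYt, h1, Finset.sum_range_sub]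
        ring
      have hut : u t = M * (y - m) := by
        have h1 := sum_mul_steep_unitRamp (c := fun _ => 1) hM' hm hm₀ h
        simp only [one_mul, Finset.sum_const, Finset.card_range, nsmul_eq_mul, mul_one] at h1
        simp only [hu, hS, ContinuousMap.smul_apply, ContinuousMap.sub_apply,
          ContinuousMap.sum_apply, steepMap_apply, smul_eq_mul, hYt, h1]
      have := hbφ m y hm₀ (by nlinarith)
      rwa [← hut, ← polygonMap_apply (hb m) (2 / M) hθt] at this
    · -- On the steep ramps the code is meaningless, but there the truncation is sharp.
      refine (htrunc.trans (min_le_right _ _)).trans ?_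
      have h1 : T t ≤ 1 / M := by
        rw [hTt, le_div_iff₀ hM']
        refine (mul_le_mul_of_nonneg_right (min_le_right _ _) hM'.le).trans ?_
        linarith
      have h2 : (8 : ℝ) / M = 4 * (1 / M) + 4 * (1 / M) := by ring
      have h3 : 0 < 1 / (M : ℝ) := by positivity
      linarith
  have e : φ y / N - ((N : ℝ)⁻¹ • (P + φ 0 • 1 + (reluMap (g + (2 : ℝ) • T) -
      reluMap (g - (2 : ℝ) • T) - (2 : ℝ) • T)) : C(Set.Icc (0 : ℝ) 1, ℝ)) t =
      (φ y - chord φ m y - (max 0 (g t + 2 * T t) - max 0 (g t - 2 * T t) - 2 * T t)) / N := by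
    simp only [ContinuousMap.smul_apply, ContinuousMap.add_apply, ContinuousMap.sub_apply,
      ContinuousMap.one_apply, reluMap_apply, smul_eq_mul, mul_one, hPt]
    ring
  rw [e, abs_div, abs_of_pos hN', ← div_div]
  exact div_le_div_of_nonneg_right key hN'.le

/-! ### The unit ball of `Lip 1` -/

theorem abs_sub_le_of_mem_unitBallLipOne {f : C(Set.Icc (0 : ℝ) 1, ℝ)}
    (hf : f ∈ unitBallLipOne) (s t : Set.Icc (0 : ℝ) 1) : |f s - f t| ≤ |(s : ℝ) - t| := by
  obtain ⟨hne, hle⟩ := hf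
  rcases eq_or_ne s t with rfl | hst
  · simp
  have hpos : 0 < |(s : ℝ) - t| := abs_pos.2 (sub_ne_zero.2 (Subtype.coe_ne_coe.2 hst))
  have h1 : |f s - f t| / |(s : ℝ) - t| ≤ lipSeminorm f :=
    le_csInf hne fun M hM => (div_le_iff₀ hpos).2 (hM s t)
  have h2 : lipSeminorm f ≤ 1 := by linarith [norm_nonneg f]
  simpa using (div_le_iff₀ hpos).1 (h1.trans h2)

theorem theoremT (n : ℕ) (hn : 1 ≤ n) :
    classError unitBallLipOne (UpsilonReLUOnUnitInterval 11 (16 * n + 2)) ≤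
      ENNReal.ofReal (6 * (n : ℝ) ^ (-2 : ℤ)) := by
  refine iSup₂_le fun f hf => ?_
  have hN : (0 : ℝ) < (2 * n : ℕ) := by exact_mod_cast (by omega : 0 < 2 * n)
  have hn' : (0 : ℝ) < n := by exact_mod_cast hn
  -- The Lipschitz extension of `f` to the line, rescaled so that `[0,1]` becomes `[0,2n]`.
  obtain ⟨g, hg, hfg⟩ := exists_upsilon_approx (N := 2 * n) (M := 2 * n) (k := 16 * n + 2)
    (φ := fun y => (2 * n : ℕ) * f (Set.projIcc 0 1 zero_le_one (y / (2 * n : ℕ))))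
    (fun s t => by
      rw [← mul_sub, abs_mul, abs_of_pos hN]
      refine (mul_le_mul_of_nonneg_left ((abs_sub_le_of_mem_unitBallLipOne hf _ _).trans
        (Set.abs_projIcc_sub_projIcc _)) hN.le).trans_eq ?_
      rw [← sub_div, abs_div, abs_of_pos hN, mul_div_cancel₀ _ hN.ne'])
    (by omega) (by omega) (by omega)
  refine iInf₂_le_of_le g hg ?_
  rw [← ofReal_norm]
  refine ENNReal.ofReal_le_ofReal ((ContinuousMap.norm_le _ (by positivity)).2 fun t => ?_)
  have h := hfg t
  rw [mul_div_cancel_left₀ _ hN.ne', mul_div_cancel_left₀ _ hN.ne', Set.projIcc_val] at h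
  rw [Real.norm_eq_abs, ContinuousMap.sub_apply]
  refine h.trans ?_
  rw [zpow_neg, ← div_eq_mul_inv, div_le_div_iff₀ (by positivity) (by positivity)]
  norm_cast
  nlinarith [Nat.zero_le (n ^ 2)]
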